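/- Theorem (Brun). For real $x$, let $\pi_2(x)$ denote the number of primes $p \leqslant x$ for which $p+2$ is also prime. Then $$\pi_2(x) = O\left(\frac{x(\log\log x)^2}{\log^2 x}\right) \qquad \text{for } x \geqslant 3,$$ that is, there is an absolute constant $C>0$ such that $\pi_2(x) \leqslant C\,\dfrac{x(\log\log x)^2}{(\log x)^2}$ for every real $x\geqslant 3$. -/

import Mathlib

/-- `twinPrimeCount x` is the number `π₂(x)` of primes `p ≤ x` for which `p + 2` is also prime. -/
noncomputable def twinPrimeCount (x : ℝ) : ℕ :=
  ((Finset.range (⌊x⌋₊ + 1)).filter fun p : ℕ => p.Prime ∧ (p + 2).Prime).card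

/-!
Brun's pure sieve. If `p ≥ z` and both `p` and `p + 2` are prime, then `n = p` is counted among the
`n ≤ x` for which `n (n + 2)` has no odd prime factor below `z`; so it is enough to bound the number
of these by a sieve.

Expanding the indicator of "no odd prime `p < z` divides `n (n + 2)`" by inclusion–exclusion over
all sets `T` of such primes would give too many error terms. The expansion is therefore cut off at
`#T ≤ 2k`, which still bounds the indicator from above, by Bonferroni's inequality
(`Finset.indicator_eq_empty_le_sum_neg_one_pow_card`). The number of `n < N` with `p ∣ n (n + 2)`
for all `p ∈ T` is `N ∏_{p ∈ T} 2 / p` up to an error of at most `2 ^ #T`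
(`abs_card_filter_dvd_mul_add_two_sub_le`). This leaves three terms (`brun_pure_sieve`):

* the main term `N ∏ (1 - 2 / p)`, which is `O (N / (log z) ^ 2)` by comparison with the Euler
  product of the harmonic series (`prod_one_sub_two_div_le`);
* the truncation error `N ∑_{#T > 2k} ∏_{p ∈ T} 2 / p`, at most
  `N exp (2 e ∑ 1 / p - 2k)` by Rankin's trick (`Finset.sum_prod_card_gt_le_exp`), where
  `∑_{p < z} 1 / p = O (log log x)` by Chebyshev's bound on dyadic blocks
  (`sum_inv_primesBelow_le`);
* the remainder `∑_{#T ≤ 2k} 2 ^ #T`, at most `e ^ 2 z ^ (2k)`, again by Rankin's trick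
  (`Finset.sum_two_pow_card_le`).

With `k` about `15 log log x` and `log z` about `log x / (64 log log x)`, the second term is
`O (x / (log x) ^ 2)`, the remainder is at most `x ^ (1 / 2)` times a power of `log x`, and the main
term is `O (x (log log x) ^ 2 / (log x) ^ 2)` (`twinPrimeCount_le_of_large`). On a bounded range
of `x` the claim holds for a suitable constant, as `log log x` is bounded below by
`log log 3 > 0` there.
-/

/-! ### Truncated inclusion–exclusion and Rankin's trick -/

open Finset in
/-- **Bonferroni's inequality**: the inclusion–exclusion expansion of the indicator of `s = ∅`,
truncated after the subsets of an even size `2 * k`, is an upper bound. For nonempty `s` the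
truncated sum equals `(#s - 1).choose (2 * k)`. -/
theorem Finset.indicator_eq_empty_le_sum_neg_one_pow_card {α : Type*} [DecidableEq α]
    (s : Finset α) (k : ℕ) :
    (if s = ∅ then 1 else 0 : ℝ) ≤ ∑ T ∈ s.powerset with #T ≤ 2 * k, (-1) ^ #T := by
  have key : (∑ T ∈ s.powerset with #T ≤ 2 * k, (-1 : ℤ) ^ #T)
      = ∑ j ∈ range (2 * k + 1), (-1 : ℤ) ^ j * (#s).choose j := by
    rw [← sum_fiberwise_of_maps_to (t := range (2 * k + 1)) (g := fun T => #T)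
      (fun T hT => by simp at hT ⊢; omega)]
    refine sum_congr rfl fun j hj => ?_
    have hset : {T ∈ {T ∈ s.powerset | #T ≤ 2 * k} | #T = j} = powersetCard j s := by
      ext T
      simp only [mem_filter, mem_powerset, mem_powersetCard, mem_range] at hj ⊢
      constructor
      · tauto
      · rintro ⟨h1, h2⟩
        exact ⟨⟨h1, by omega⟩, h2⟩
    rw [hset, sum_congr rfl (g := fun _ => (-1 : ℤ) ^ j)
      (fun T hT => by rw [(mem_powersetCard.1 hT).2]), sum_const, card_powersetCard]
    simp [mul_comm]
  have main : (if s = ∅ then 1 else 0 : ℤ) ≤ ∑ T ∈ s.powerset with #T ≤ 2 * k, (-1) ^ #T := by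
    rw [key]
    rcases s.eq_empty_or_nonempty with rfl | hs
    · rw [sum_range_succ']
      simp
    · rw [if_neg hs.ne_empty]
      obtain ⟨n, hn⟩ := Nat.exists_eq_succ_of_ne_zero hs.card_ne_zero
      rw [hn, Nat.succ_eq_add_one, Int.alternating_sum_range_choose_eq_choose]
      simp [pow_mul]
  exact_mod_cast main

open Finset in
/-- **Rankin's trick** for elementary symmetric functions: each set `T` with `m < #T` is weighted by
`exp (#T - m) ≥ 1`, after which the sum over all `T` is an Euler product. -/
theorem Finset.sum_prod_card_gt_le_exp {α : Type*} [DecidableEq α] (s : Finset α) (g : α → ℝ)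
    (hg : ∀ a ∈ s, 0 ≤ g a) (m : ℕ) :
    ∑ T ∈ s.powerset with m < #T, ∏ a ∈ T, g a ≤
      Real.exp (Real.exp 1 * ∑ a ∈ s, g a - m) := by
  have h1 : ∏ a ∈ s, (1 + Real.exp 1 * g a) ≤ Real.exp (Real.exp 1 * ∑ a ∈ s, g a) := by
    rw [mul_sum, Real.exp_sum]
    refine prod_le_prod (fun a ha => ?_) (fun a ha => ?_)
    · have := hg a ha; positivity
    · rw [add_comm]; exact Real.add_one_le_exp _
  rw [Real.exp_sub, le_div_iff₀ (Real.exp_pos _)]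
  refine le_trans ?_ h1
  rw [prod_one_add, sum_mul]
  refine (sum_le_sum fun T hT => ?_).trans
    (sum_le_sum_of_subset_of_nonneg (filter_subset _ _) fun T hT _ => ?_)
  · simp only [mem_filter, mem_powerset] at hT
    rw [prod_mul_distrib, prod_const, mul_comm, ← Real.exp_nat_mul, mul_one]
    refine mul_le_mul_of_nonneg_right ?_ (prod_nonneg fun a ha => hg a (hT.1 ha))
    exact Real.exp_le_exp.2 (by exact_mod_cast hT.2.le)
  · refine prod_nonneg fun a ha => ?_
    have := hg a (mem_powerset.1 hT ha)
    positivity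

open Finset in
/-- Rankin's trick in the opposite direction: each set `T` with `#T ≤ m` is weighted by
`z ^ (m - #T) ≥ 1`, and the resulting product `(1 + 2 / z) ^ #s` is at most `exp 2`. -/
theorem Finset.sum_two_pow_card_le {α : Type*} [DecidableEq α] (s : Finset α) (m z : ℕ)
    (hz : 1 ≤ z) (hs : #s ≤ z) :
    ∑ T ∈ s.powerset with #T ≤ m, (2 : ℝ) ^ #T ≤ Real.exp 2 * (z : ℝ) ^ m := by
  have hz' : (1 : ℝ) ≤ z := by exact_mod_cast hz
  have h1 : ∏ _a ∈ s, (1 + 2 / (z : ℝ)) ≤ Real.exp 2 := by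
    rw [prod_const]
    calc (1 + 2 / (z : ℝ)) ^ #s ≤ (Real.exp (2 / z)) ^ #s := by
          gcongr
          rw [add_comm]; exact Real.add_one_le_exp _
      _ = Real.exp (#s * (2 / z)) := by rw [← Real.exp_nat_mul]
      _ ≤ Real.exp 2 := by
          apply Real.exp_le_exp.2
          rw [mul_div_assoc', div_le_iff₀ (by linarith)]
          have : (#s : ℝ) ≤ z := by exact_mod_cast hs
          linarith
  refine le_trans ?_ (mul_le_mul_of_nonneg_right h1 (by positivity))
  rw [prod_one_add, sum_mul]
  refine (sum_le_sum fun T hT => ?_).trans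
    (sum_le_sum_of_subset_of_nonneg (filter_subset _ _) fun T hT _ => by positivity)
  simp only [mem_filter, mem_powerset] at hT
  rw [prod_const, div_pow, div_mul_eq_mul_div, le_div_iff₀ (by positivity)]
  gcongr
  exact hT.2

/-! ### Simultaneous divisibility of `n (n + 2)` -/

theorem Nat.abs_count_modEq_sub_div_le_one {q : ℕ} (hq : 0 < q) (N a : ℕ) :
    |(N.count (· ≡ a [MOD q]) : ℝ) - N / q| ≤ 1 := by
  rw [Nat.count_modEq_card N hq]
  have h1 : (N : ℝ) = q * (N / q : ℕ) + (N % q : ℕ) := by exact_mod_cast (Nat.div_add_mod N q).symm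
  have hq' : (0 : ℝ) < q := by exact_mod_cast hq
  have h2 : ((N % q : ℕ) : ℝ) ≤ q := by exact_mod_cast (Nat.mod_lt N hq).le
  have h3 : (N : ℝ) / q = (N / q : ℕ) + (N % q : ℕ) / q := by
    rw [h1]; field_simp
  have h4 : ((N % q : ℕ) : ℝ) / q ≤ 1 := by rw [div_le_one hq']; exact h2
  have h5 : 0 ≤ ((N % q : ℕ) : ℝ) / q := by positivity
  rw [h3, abs_le]
  split_ifs <;> constructor <;> push_cast <;> linarith

open Finset in
/-- The local densities of the twin prime sieve, inside an arithmetic progression `a` mod `q`. The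
progression makes the induction on `T` work: for an odd prime `p`, the condition
`p ∣ n * (n + 2)` splits `a` mod `q` into exactly two progressions mod `q * p`, so that adjoining
`p` to `T` doubles the number of progressions, each of which contributes an error of at most `1`. -/
theorem abs_card_filter_dvd_mul_add_two_sub_le (N : ℕ) (T : Finset ℕ)
    (hT : ∀ p ∈ T, p.Prime ∧ p ≠ 2) :
    ∀ q a : ℕ, 0 < q → (∀ p ∈ T, q.Coprime p) →
      |(#{n ∈ range N | n ≡ a [MOD q] ∧ ∀ p ∈ T, p ∣ n * (n + 2)} : ℝ)
        - N / q * ∏ p ∈ T, (2 / (p : ℝ))| ≤ 2 ^ #T := by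
  induction T using Finset.induction_on with
  | empty =>
    intro q a hq _
    have := Nat.abs_count_modEq_sub_div_le_one hq N a
    rw [Nat.count_eq_card_filter_range] at this
    simpa using this
  | insert p T hpT ih =>
    intro q a hq hco
    obtain ⟨hp, hp2⟩ := hT p (mem_insert_self _ _)
    have hqp : q.Coprime p := hco p (mem_insert_self _ _)
    have hT' : ∀ r ∈ T, r.Prime ∧ r ≠ 2 := fun r hr => hT r (mem_insert_of_mem hr)
    -- `b` and `c` are the residues mod `q * p` above `a` with `p ∣ b` and `p ∣ c + 2`
    obtain ⟨b, hb1, hb2⟩ := Nat.chineseRemainder hqp a 0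
    obtain ⟨c, hc1, hc2⟩ := Nat.chineseRemainder hqp a (p - 2)
    have hp3 : 2 ≤ p := hp.two_le
    have hco' : ∀ r ∈ T, (q * p).Coprime r := fun r hr =>
      Nat.Coprime.mul_left (hco r (mem_insert_of_mem hr))
        ((Nat.coprime_primes hp (hT' r hr).1).2 (fun h => hpT (h ▸ hr)))
    have hB := ih hT' (q * p) b (by positivity) hco'
    have hC := ih hT' (q * p) c (by positivity) hco'
    have hdisj : ∀ n : ℕ, p ∣ n → p ∣ n + 2 → False := fun n h1 h2 => by
      have := (Nat.dvd_add_right h1).1 h2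
      exact hp2 ((Nat.prime_dvd_prime_iff_eq hp Nat.prime_two).1 this)
    have e1 : ∀ n, n ≡ b [MOD q * p] ↔ n ≡ a [MOD q] ∧ p ∣ n := fun n => by
      rw [← Nat.modEq_and_modEq_iff_modEq_mul hqp]
      refine and_congr ⟨fun h => h.trans hb1, fun h => h.trans hb1.symm⟩ ?_
      rw [← Nat.modEq_zero_iff_dvd]
      exact ⟨fun h => h.trans hb2, fun h => h.trans hb2.symm⟩
    have e2 : ∀ n, n ≡ c [MOD q * p] ↔ n ≡ a [MOD q] ∧ p ∣ n + 2 := fun n => by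
      rw [← Nat.modEq_and_modEq_iff_modEq_mul hqp]
      refine and_congr ⟨fun h => h.trans hc1, fun h => h.trans hc1.symm⟩ ?_
      have hp0 : p - 2 + 2 ≡ 0 [MOD p] := by
        rw [Nat.sub_add_cancel hp3]; simp [Nat.ModEq]
      rw [← Nat.modEq_zero_iff_dvd]
      exact ⟨fun h => ((h.trans hc2).add_right 2).trans hp0,
        fun h => (Nat.ModEq.add_right_cancel' 2 (h.trans hp0.symm)).trans hc2.symm⟩
    have hsplit : #{n ∈ range N | n ≡ a [MOD q] ∧ ∀ r ∈ insert p T, r ∣ n * (n + 2)}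
        = #{n ∈ range N | n ≡ b [MOD q * p] ∧ ∀ r ∈ T, r ∣ n * (n + 2)}
          + #{n ∈ range N | n ≡ c [MOD q * p] ∧ ∀ r ∈ T, r ∣ n * (n + 2)} := by
      rw [← card_union_of_disjoint]
      · congr 1
        ext n
        simp only [mem_union, mem_filter, forall_mem_insert, e1, e2, hp.dvd_mul]
        tauto
      · rw [disjoint_left]
        intro n h1 h2
        simp only [mem_filter, e1, e2] at h1 h2
        exact hdisj n h1.2.1.2 h2.2.1.2
    rw [hsplit, card_insert_of_notMem hpT, prod_insert hpT]
    have hpos : (p : ℝ) ≠ 0 := by exact_mod_cast hp.ne_zero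
    have hqpos : (q : ℝ) ≠ 0 := by exact_mod_cast hq.ne'
    have hM : (N : ℝ) / q * (2 / p * ∏ r ∈ T, (2 / (r : ℝ)))
        = N / (q * p : ℕ) * ∏ r ∈ T, (2 / (r : ℝ)) + N / (q * p : ℕ) * ∏ r ∈ T, (2 / (r : ℝ)) := by
      push_cast
      field_simp
      ring
    rw [hM]
    push_cast at hB hC ⊢
    rw [abs_le] at hB hC ⊢
    rw [pow_succ]
    constructor <;> linarith [hB.1, hB.2, hC.1, hC.2]

/-! ### The sieve inequality -/

open Finset in
/-- **Brun's pure sieve** for `n (n + 2)`, with inclusion–exclusion truncated at level `2 * k`. The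
three terms are the main term, the completion of the main term to all subsets of `P`, and the
accumulated rounding errors. -/
theorem brun_pure_sieve (N z k : ℕ) (hz : 1 ≤ z) (P : Finset ℕ)
    (hP : ∀ p ∈ P, p.Prime ∧ p ≠ 2) (hPz : #P ≤ z) :
    (#{n ∈ range N | ∀ p ∈ P, ¬ p ∣ n * (n + 2)} : ℝ) ≤
      N * ∏ p ∈ P, (1 - 2 / (p : ℝ))
        + N * Real.exp (Real.exp 1 * ∑ p ∈ P, (2 / (p : ℝ)) - (2 * k : ℕ))
        + Real.exp 2 * (z : ℝ) ^ (2 * k) := by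
  set S : ℕ → Finset ℕ := fun n => {p ∈ P | p ∣ n * (n + 2)} with hS
  set F : Finset (Finset ℕ) := {T ∈ P.powerset | #T ≤ 2 * k} with hF
  set A : Finset ℕ → ℝ := fun T => #{n ∈ range N | ∀ p ∈ T, p ∣ n * (n + 2)} with hA
  set G : Finset ℕ → ℝ := fun T => ∏ p ∈ T, (2 / (p : ℝ)) with hG
  have step1 : (#{n ∈ range N | ∀ p ∈ P, ¬ p ∣ n * (n + 2)} : ℝ) ≤
      ∑ T ∈ F, (-1) ^ #T * A T := by
    calc (#{n ∈ range N | ∀ p ∈ P, ¬ p ∣ n * (n + 2)} : ℝ)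
        = ∑ n ∈ range N, (if S n = ∅ then 1 else 0 : ℝ) := by
          rw [card_filter]
          push_cast
          refine sum_congr rfl fun n _ => ?_
          simp only [hS, filter_eq_empty_iff]
      _ ≤ ∑ n ∈ range N, ∑ T ∈ (S n).powerset with #T ≤ 2 * k, (-1) ^ #T :=
          sum_le_sum fun n _ => indicator_eq_empty_le_sum_neg_one_pow_card (S n) k
      _ = ∑ n ∈ range N, ∑ T ∈ F, if ∀ p ∈ T, p ∣ n * (n + 2) then (-1) ^ #T else 0 := by
          refine sum_congr rfl fun n _ => ?_
          rw [← sum_filter]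
          congr 1
          ext T
          simp only [hS, hF, mem_filter, mem_powerset, subset_iff]
          grind
      _ = ∑ T ∈ F, (-1) ^ #T * A T := by
          rw [sum_comm]
          refine sum_congr rfl fun T _ => ?_
          rw [← sum_filter, sum_const, nsmul_eq_mul, mul_comm]
  have step2 : ∀ T ∈ F, (-1) ^ #T * A T ≤ N * ((-1) ^ #T * G T) + 2 ^ #T := fun T hT => by
    have hTP : T ⊆ P := mem_powerset.1 (mem_filter.1 hT).1
    have h := abs_card_filter_dvd_mul_add_two_sub_le N T (fun p hp => hP p (hTP hp)) 1 0 one_pos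
      (fun p _ => Nat.coprime_one_left p)
    simp only [Nat.modEq_one, true_and, Nat.cast_one, div_one] at h
    change |A T - N * G T| ≤ _ at h
    rw [abs_le] at h
    rcases neg_one_pow_eq_or ℝ #T with h' | h' <;> rw [h'] <;> linarith [h.1, h.2]
  have hG0 : ∀ T, 0 ≤ G T := fun T => prod_nonneg fun p _ => by positivity
  have step3 : ∑ T ∈ F, (-1) ^ #T * G T ≤ ∏ p ∈ P, (1 - 2 / (p : ℝ))
      + Real.exp (Real.exp 1 * ∑ p ∈ P, (2 / (p : ℝ)) - (2 * k : ℕ)) := by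
    have h1 : ∏ p ∈ P, (1 - 2 / (p : ℝ)) = ∑ T ∈ P.powerset, (-1) ^ #T * G T := by
      simp_rw [sub_eq_add_neg, prod_one_add, prod_neg]
      rfl
    have h2 : ∑ T ∈ P.powerset with ¬ #T ≤ 2 * k, G T ≤
        Real.exp (Real.exp 1 * ∑ p ∈ P, (2 / (p : ℝ)) - (2 * k : ℕ)) := by
      simp_rw [not_le]
      exact sum_prod_card_gt_le_exp P (fun p => 2 / (p : ℝ)) (fun p _ => by positivity) (2 * k)
    have h3 : -∑ T ∈ P.powerset with ¬ #T ≤ 2 * k, (-1) ^ #T * G T ≤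
        ∑ T ∈ P.powerset with ¬ #T ≤ 2 * k, G T := by
      rw [← sum_neg_distrib]
      refine sum_le_sum fun T _ => ?_
      rcases neg_one_pow_eq_or ℝ #T with h' | h' <;> rw [h'] <;> linarith [hG0 T]
    rw [h1, ← sum_filter_add_sum_filter_not P.powerset (fun T => #T ≤ 2 * k)]
    linarith
  have step4 := sum_two_pow_card_le P (2 * k) z hz hPz
  calc _ ≤ ∑ T ∈ F, (-1) ^ #T * A T := step1
    _ ≤ ∑ T ∈ F, (N * ((-1) ^ #T * G T) + 2 ^ #T) := sum_le_sum step2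
    _ = N * ∑ T ∈ F, (-1) ^ #T * G T + ∑ T ∈ F, 2 ^ #T := by rw [sum_add_distrib, mul_sum]
    _ ≤ _ := by
      have := mul_le_mul_of_nonneg_left step3 (Nat.cast_nonneg (α := ℝ) N)
      rw [mul_add] at this
      exact add_le_add this step4

/-! ### Mertens-type bounds -/

/-- The right side is the sum of `1 / n` over all `n` with every prime factor below `z`, among them
all `1 ≤ n < z`. -/
theorem Real.log_le_prod_primesBelow_inv (z : ℕ) (hz : 1 ≤ z) :
    Real.log z ≤ ∏ p ∈ z.primesBelow, (1 - (p : ℝ)⁻¹)⁻¹ := by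
  let f : ℕ →* ℝ := ⟨⟨fun n => (n : ℝ)⁻¹, by simp⟩, fun a b => by simp [mul_comm]⟩
  have hf : ∀ n : ℕ, f n = (n : ℝ)⁻¹ := fun n => rfl
  obtain ⟨-, hsum⟩ := EulerProduct.summable_and_hasSum_smoothNumbers_prod_primesBelow_geometric
    (f := f) (fun {p} hp => by
      rw [hf, norm_inv, Real.norm_natCast]
      exact inv_lt_one_of_one_lt₀ (by exact_mod_cast hp.one_lt)) z
  obtain ⟨n, rfl⟩ : ∃ n, z = n + 1 := ⟨z - 1, by omega⟩
  calc Real.log ((n + 1 : ℕ) : ℝ) ≤ (harmonic n : ℝ) := log_add_one_le_harmonic n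
    _ = ∑ m ∈ Finset.range n, f (m + 1) := by
        rw [harmonic]; push_cast; refine Finset.sum_congr rfl fun m _ => ?_
        rw [hf]; push_cast; rfl
    _ = ∑ m : Fin n, f (m + 1) := (Fin.sum_univ_eq_sum_range (fun m => f (m + 1)) n).symm
    _ ≤ ∏ p ∈ (n + 1).primesBelow, (1 - f p)⁻¹ := by
        let e : Fin n ↪ (n + 1).smoothNumbers :=
          ⟨fun m => ⟨m + 1, Nat.mem_smoothNumbers_of_lt (by omega) (by omega)⟩, fun a b h => by
            simp only [Subtype.mk.injEq] at h; omega⟩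
        have := sum_le_hasSum (Finset.univ.map e) (fun m _ => by rw [hf]; positivity) hsum
        rw [Finset.sum_map] at this
        exact this

/-- Upper bound for the density of the sifted set, from `1 - 2 / p ≤ (1 - 1 / p) ^ 2`; the constant
`4` makes up for the missing factor at the prime `2`. -/
theorem prod_one_sub_two_div_le (z : ℕ) (hz : 3 ≤ z) :
    ∏ p ∈ z.primesBelow.erase 2, (1 - 2 / (p : ℝ)) ≤ 4 / Real.log z ^ 2 := by
  have h2 : 2 ∈ z.primesBelow := Nat.mem_primesBelow.2 ⟨by omega, Nat.prime_two⟩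
  have hlog : 0 < Real.log z := Real.log_pos (by exact_mod_cast (by omega : 1 < z))
  set Q := ∏ p ∈ z.primesBelow.erase 2, (1 - (p : ℝ)⁻¹) with hQ
  have hp3 : ∀ p ∈ z.primesBelow.erase 2, (3 : ℝ) ≤ p := fun p hp => by
    obtain ⟨hne, hp⟩ := Finset.mem_erase.1 hp
    have := (Nat.prime_of_mem_primesBelow hp).two_le
    exact_mod_cast (by omega : 3 ≤ p)
  have hinv : ∀ p ∈ z.primesBelow.erase 2, (p : ℝ)⁻¹ ≤ 3⁻¹ := fun p hp =>
    inv_anti₀ (by norm_num) (hp3 p hp)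
  have hQpos : 0 < Q := Finset.prod_pos fun p hp => by
    have := hinv p hp; norm_num at this ⊢; linarith
  have hlogQ : Real.log z ≤ 2 * Q⁻¹ := by
    have h := Real.log_le_prod_primesBelow_inv z (by omega)
    rw [← Finset.mul_prod_erase _ _ h2, Finset.prod_inv_distrib] at h
    norm_num at h ⊢
    exact h
  calc ∏ p ∈ z.primesBelow.erase 2, (1 - 2 / (p : ℝ))
      ≤ ∏ p ∈ z.primesBelow.erase 2, (1 - (p : ℝ)⁻¹) ^ 2 := by
        refine Finset.prod_le_prod (fun p hp => ?_) (fun p hp => ?_)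
        · have := hinv p hp
          rw [div_eq_mul_inv]; norm_num at this; linarith
        · rw [div_eq_mul_inv]; nlinarith [sq_nonneg (p : ℝ)⁻¹]
    _ = Q ^ 2 := Finset.prod_pow _ _ _
    _ ≤ 4 / Real.log z ^ 2 := by
        rw [le_div_iff₀ (by positivity), ← mul_pow]
        have h1 : Q * Real.log z ≤ 2 := by
          calc Q * Real.log z ≤ Q * (2 * Q⁻¹) := by gcongr
            _ = 2 := by field_simp
        nlinarith [mul_pos hQpos hlog]

open Finset in
/-- A dyadic block contains `O (2 ^ k / k)` primes, since their product divides a primorial, and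
`primorial n ≤ 4 ^ n`. -/
theorem sum_inv_primes_Ico_two_pow_le (k : ℕ) :
    ∑ p ∈ Ico (2 ^ (k + 1) : ℕ) (2 ^ (k + 2)) with p.Prime, (p : ℝ)⁻¹ ≤ 4 * ((k : ℝ) + 1)⁻¹ := by
  set B := {p ∈ Ico (2 ^ (k + 1) : ℕ) (2 ^ (k + 2)) | p.Prime} with hB
  have h1 : (2 ^ (k + 1)) ^ #B ≤ 4 ^ 2 ^ (k + 2) := by
    refine le_trans ?_ (primorial_le_four_pow _)
    calc (2 ^ (k + 1)) ^ #B ≤ ∏ p ∈ B, p :=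
          pow_card_le_prod _ _ _ fun p hp => (mem_Ico.1 (mem_filter.1 hp).1).1
      _ ≤ primorial (2 ^ (k + 2)) := by
          refine prod_le_prod_of_subset_of_one_le' ?_ ?_
          · intro p hp
            simp only [hB, mem_filter, mem_Ico, mem_range] at hp ⊢
            exact ⟨by omega, hp.2⟩
          · intro p hp _
            exact (mem_filter.1 hp).2.one_lt.le
  have h2 : (k + 1) * #B ≤ 2 * 2 ^ (k + 2) := by
    rw [← pow_mul, show (4 : ℕ) = 2 ^ 2 by norm_num, ← pow_mul] at h1
    exact (Nat.pow_le_pow_iff_right (by norm_num)).1 h1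
  have h3 : ((k : ℝ) + 1) * #B ≤ 2 * 2 ^ (k + 2) := by exact_mod_cast h2
  calc ∑ p ∈ B, (p : ℝ)⁻¹ ≤ ∑ _p ∈ B, ((2 : ℝ) ^ (k + 1))⁻¹ := by
        refine sum_le_sum fun p hp => inv_anti₀ (by positivity) ?_
        exact_mod_cast (mem_Ico.1 (mem_filter.1 hp).1).1
    _ = #B * ((2 : ℝ) ^ (k + 1))⁻¹ := by rw [sum_const, nsmul_eq_mul]
    _ ≤ 4 * ((k : ℝ) + 1)⁻¹ := by
        rw [← div_eq_mul_inv, ← div_eq_mul_inv, div_le_div_iff₀ (by positivity) (by positivity)]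
        calc (#B : ℝ) * (k + 1) = (k + 1) * #B := mul_comm _ _
          _ ≤ _ := h3
          _ = 4 * 2 ^ (k + 1) := by ring

open Finset in
theorem sum_inv_primesBelow_two_pow_le_harmonic (k : ℕ) :
    ∑ p ∈ Nat.primesBelow (2 ^ (k + 1)), (p : ℝ)⁻¹ ≤ 4 * harmonic k := by
  induction k with
  | zero => simp [Nat.primesBelow, show range 2 = {0, 1} from rfl, filter_insert, filter_singleton,
      Nat.not_prime_zero, Nat.not_prime_one]
  | succ k ih =>
    have hsplit : Nat.primesBelow (2 ^ (k + 2)) =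
        Nat.primesBelow (2 ^ (k + 1)) ∪ {p ∈ Ico (2 ^ (k + 1)) (2 ^ (k + 2)) | p.Prime} := by
      have : 2 ^ (k + 1) ≤ 2 ^ (k + 2) := Nat.pow_le_pow_right (by norm_num) (by omega)
      ext p
      simp only [mem_union, mem_filter, mem_Ico, Nat.mem_primesBelow]
      have := lt_or_ge p (2 ^ (k + 1))
      grind
    rw [show k + 1 + 1 = k + 2 from rfl, hsplit, sum_union, harmonic_succ]
    · have := sum_inv_primes_Ico_two_pow_le k
      push_cast
      linarith
    · rw [disjoint_left]
      intro p h1 h2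
      simp only [mem_filter, mem_Ico, Nat.mem_primesBelow] at h1 h2
      omega

theorem sum_inv_primesBelow_le (z K : ℕ) (hK : 1 ≤ K) (hz : z ≤ 2 ^ K) :
    ∑ p ∈ z.primesBelow, (p : ℝ)⁻¹ ≤ 4 + 4 * Real.log K := by
  obtain ⟨k, rfl⟩ : ∃ k, K = k + 1 := ⟨K - 1, by omega⟩
  have h1 : ∑ p ∈ z.primesBelow, (p : ℝ)⁻¹ ≤ ∑ p ∈ Nat.primesBelow (2 ^ (k + 1)), (p : ℝ)⁻¹ := by
    refine Finset.sum_le_sum_of_subset_of_nonneg (fun p hp => ?_) (fun _ _ _ => by positivity)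
    rw [Nat.mem_primesBelow] at hp ⊢
    exact ⟨hp.1.trans_le hz, hp.2⟩
  have h2 := harmonic_le_one_add_log k
  have h3 : Real.log k ≤ Real.log ((k + 1 : ℕ) : ℝ) := by
    rcases k.eq_zero_or_pos with rfl | hk
    · simp
    · exact Real.log_le_log (by exact_mod_cast hk) (by push_cast; linarith)
  linarith [sum_inv_primesBelow_two_pow_le_harmonic k]

/-! ### Choice of parameters -/

open Finset in
/-- A twin prime pair `p, p + 2` with `p ≥ z` survives sieving by the odd primes below `z`, and the
remaining pairs number at most `z`. The sieve runs over the odd primes only because `0` and `-2`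
coincide modulo `2`. -/
theorem twinPrimeCount_le_sieve (x : ℝ) (z k : ℕ) (hz : 3 ≤ z) :
    (twinPrimeCount x : ℝ) ≤ z + (⌊x⌋₊ + 1 : ℕ) * (4 / Real.log z ^ 2)
      + (⌊x⌋₊ + 1 : ℕ) * Real.exp (Real.exp 1 * (2 * ∑ p ∈ z.primesBelow, (p : ℝ)⁻¹) - (2 * k : ℕ))
      + Real.exp 2 * (z : ℝ) ^ (2 * k) := by
  set P := z.primesBelow.erase 2 with hPdef
  set N := ⌊x⌋₊ + 1 with hN
  have hP : ∀ p ∈ P, p.Prime ∧ p ≠ 2 := fun p hp =>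
    ⟨Nat.prime_of_mem_primesBelow (mem_of_mem_erase hp), ne_of_mem_erase hp⟩
  have hlt : ∀ p ∈ P, p < z := fun p hp => Nat.lt_of_mem_primesBelow (mem_of_mem_erase hp)
  have hPz : #P ≤ z := by
    calc #P ≤ #(range z) := card_le_card fun p hp => mem_range.2 (hlt p hp)
      _ = z := card_range z
  have hsub : {p ∈ range N | p.Prime ∧ (p + 2).Prime} ⊆
      range z ∪ {n ∈ range N | ∀ p ∈ P, ¬ p ∣ n * (n + 2)} := by
    intro n hn
    simp only [mem_union, mem_filter, mem_range] at hn ⊢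
    rcases lt_or_ge n z with h | h
    · exact Or.inl h
    · refine Or.inr ⟨hn.1, fun p hp hdvd => ?_⟩
      have hpz := hlt p hp
      rcases (hP p hp).1.dvd_mul.1 hdvd with h' | h'
      · have := (Nat.prime_dvd_prime_iff_eq (hP p hp).1 hn.2.1).1 h'
        omega
      · have := (Nat.prime_dvd_prime_iff_eq (hP p hp).1 hn.2.2).1 h'
        omega
  have hcard : (twinPrimeCount x : ℝ) ≤ z + #{n ∈ range N | ∀ p ∈ P, ¬ p ∣ n * (n + 2)} := by
    have h := (card_le_card hsub).trans (card_union_le _ _)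
    rw [card_range] at h
    exact_mod_cast h
  have hsum : ∑ p ∈ P, (2 / (p : ℝ)) ≤ 2 * ∑ p ∈ z.primesBelow, (p : ℝ)⁻¹ := by
    rw [mul_sum]
    simp_rw [div_eq_mul_inv]
    exact sum_le_sum_of_subset_of_nonneg (erase_subset _ _) fun _ _ _ => by positivity
  have hsieve := brun_pure_sieve N z k (by omega) P hP hPz
  have hexp : (N : ℝ) * Real.exp (Real.exp 1 * ∑ p ∈ P, (2 / (p : ℝ)) - (2 * k : ℕ)) ≤
      N * Real.exp (Real.exp 1 * (2 * ∑ p ∈ z.primesBelow, (p : ℝ)⁻¹) - (2 * k : ℕ)) := by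
    gcongr
  have hprod : (N : ℝ) * ∏ p ∈ P, (1 - 2 / (p : ℝ)) ≤ N * (4 / Real.log z ^ 2) := by
    gcongr
    exact prod_one_sub_two_div_le z hz
  linarith

set_option maxHeartbeats 400000 in
/-- The sieve bound with `log z ≈ log x / (64 log log x)` and `k ≈ 15 log log x`. Then `2 * k` is
at least `30 log log x`, which exceeds `2 e ∑ 1 / p` by at least `2 log log x` and makes the
truncation error `O (x / (log x) ^ 2)`; and `2 * k ≤ 32 log log x` keeps `z ^ (2 * k)` below
`x ^ (1 / 2) (log x) ^ 32`. The hypothesis `hpow` absorbs that power of the logarithm. -/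
theorem twinPrimeCount_le_of_large (x : ℝ) (hx : 1 ≤ x) (hl : 8 ≤ Real.log (Real.log x))
    (hy : 2 ≤ Real.log x / (64 * Real.log (Real.log x)))
    (hpow : Real.log x ^ 34 ≤ Real.exp (Real.log x / 2)) :
    (twinPrimeCount x : ℝ) ≤
      40000 * (x * (Real.log (Real.log x)) ^ 2 / (Real.log x) ^ 2) := by
  set L := Real.log x with hL
  set l := Real.log L with hldef
  have hL8 : 8 ≤ L := by nlinarith [(le_div_iff₀ (by positivity : 0 < 64 * l)).1 hy]
  have hexpL : Real.exp L = x := Real.exp_log (by linarith)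
  have hexpl : Real.exp l = L := Real.exp_log (by linarith)
  set t := L / (64 * l) with ht
  have htL : t * (64 * l) = L := div_mul_cancel₀ _ (by positivity)
  have ht512 : 512 * t ≤ L := by nlinarith
  set y := Real.exp t with hydef
  have hy3 : 3 ≤ y := by have := Real.add_one_le_exp t; linarith
  set z := ⌈y⌉₊ with hzdef
  have hyz : y ≤ z := Nat.le_ceil y
  have hz3 : 3 ≤ z := by exact_mod_cast hy3.trans hyz
  have hzexp : (z : ℝ) ≤ Real.exp (1 + t) := by
    rw [Real.exp_add]
    have h1 : (z : ℝ) < y + 1 := Nat.ceil_lt_add_one (by positivity)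
    have h2 := Real.add_one_le_exp (1 : ℝ)
    nlinarith
  have hlogz : t ≤ Real.log z := by
    rw [Real.le_log_iff_exp_le (by positivity)]
    exact hyz
  -- every prime below `z` is below `2 ^ K`, where `K` is of the order of `log x`
  set K := ⌈L / Real.log 2⌉₊ with hKdef
  have hlog2 := Real.log_two_gt_d9
  have hKL : L ≤ K * Real.log 2 := by
    rw [← div_le_iff₀ (by linarith)]
    exact Nat.le_ceil _
  have hK2 : (K : ℝ) ≤ 2 * L := by
    have h1 : (K : ℝ) < L / Real.log 2 + 1 := Nat.ceil_lt_add_one (by positivity)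
    have h2 : L / Real.log 2 ≤ 3 / 2 * L := by
      rw [div_le_iff₀ (by linarith)]; nlinarith
    linarith
  have hK1 : 1 ≤ K := Nat.one_le_ceil_iff.2 (by positivity)
  have hzK : z ≤ 2 ^ K := by
    have : (z : ℝ) ≤ 2 ^ K := by
      calc (z : ℝ) ≤ Real.exp (1 + t) := hzexp
        _ ≤ Real.exp (K * Real.log 2) := Real.exp_le_exp.2 (by linarith)
        _ = 2 ^ K := by rw [Real.exp_nat_mul, Real.exp_log (by norm_num)]
    exact_mod_cast this
  have hS : ∑ p ∈ z.primesBelow, (p : ℝ)⁻¹ ≤ 5 * l := by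
    have h1 := sum_inv_primesBelow_le z K hK1 hzK
    have h2 : Real.log K ≤ Real.log 2 + l := by
      rw [hldef, ← Real.log_mul (by norm_num) (by positivity)]
      exact Real.log_le_log (by exact_mod_cast hK1) hK2
    linarith [Real.log_two_lt_d9]
  set k := ⌈15 * l⌉₊ with hkdef
  have hk1 : 15 * l ≤ k := Nat.le_ceil _
  have hk2 : (k : ℝ) ≤ 16 * l := by
    have : (k : ℝ) < 15 * l + 1 := Nat.ceil_lt_add_one (by positivity)
    linarith
  have hx0 : 0 ≤ x := by linarith
  have hN : ((⌊x⌋₊ + 1 : ℕ) : ℝ) ≤ 2 * x := by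
    have := Nat.floor_le hx0
    push_cast
    linarith
  set R := x / L ^ 2 with hR
  have hR0 : 0 ≤ R := by positivity
  have hhalf : Real.exp (L / 2) * L ^ 32 ≤ R := by
    rw [hR, le_div_iff₀ (by positivity), mul_assoc, ← pow_add, ← hexpL]
    calc Real.exp (L / 2) * L ^ 34 ≤ Real.exp (L / 2) * Real.exp (L / 2) := by gcongr
      _ = Real.exp L := by rw [← Real.exp_add]; ring_nf
  have hb1 : (z : ℝ) ≤ R := by
    calc (z : ℝ) ≤ Real.exp (1 + t) := hzexp
      _ ≤ Real.exp (L / 2) := Real.exp_le_exp.2 (by linarith)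
      _ ≤ Real.exp (L / 2) * L ^ 32 :=
        le_mul_of_one_le_right (Real.exp_pos _).le (one_le_pow₀ (by linarith))
      _ ≤ R := hhalf
  have hb2 : ((⌊x⌋₊ + 1 : ℕ) : ℝ) * (4 / Real.log z ^ 2) ≤ 32768 * l ^ 2 * R := by
    calc ((⌊x⌋₊ + 1 : ℕ) : ℝ) * (4 / Real.log z ^ 2) ≤ 2 * x * (4 / t ^ 2) := by gcongr
      _ = 32768 * l ^ 2 * R := by
        rw [hR, ht]
        field_simp
        norm_num
  have hb3 : ((⌊x⌋₊ + 1 : ℕ) : ℝ) * Real.exp (Real.exp 1 *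
      (2 * ∑ p ∈ z.primesBelow, (p : ℝ)⁻¹) - (2 * k : ℕ)) ≤ 2 * R := by
    have h1 : Real.exp 1 * (2 * ∑ p ∈ z.primesBelow, (p : ℝ)⁻¹) - (2 * k : ℕ) ≤ -(2 * l) := by
      have h2 : Real.exp 1 * (2 * ∑ p ∈ z.primesBelow, (p : ℝ)⁻¹) ≤ 2.8 * (2 * (5 * l)) := by
        gcongr
        linarith [Real.exp_one_lt_d9]
      push_cast
      linarith
    calc _ ≤ 2 * x * Real.exp (-(2 * l)) := by gcongr
      _ = 2 * R := by
        rw [Real.exp_neg, show 2 * l = (2 : ℕ) * l by norm_num, Real.exp_nat_mul, hexpl, hR]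
        ring
  have hb4 : Real.exp 2 * (z : ℝ) ^ (2 * k) ≤ 9 * R := by
    have he : Real.exp 2 ≤ 9 := by
      rw [show (2 : ℝ) = (2 : ℕ) * 1 by norm_num, Real.exp_nat_mul]
      nlinarith [Real.exp_one_lt_d9, Real.exp_pos 1]
    have h1 : (z : ℝ) ^ (2 * k) ≤ R := by
      calc (z : ℝ) ^ (2 * k) ≤ Real.exp (1 + t) ^ (2 * k) := by gcongr
        _ = Real.exp ((2 * k : ℕ) * (1 + t)) := by rw [← Real.exp_nat_mul]
        _ ≤ Real.exp (L / 2 + (32 : ℕ) * l) := by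
          apply Real.exp_le_exp.2
          push_cast
          nlinarith
        _ = Real.exp (L / 2) * L ^ 32 := by rw [Real.exp_add, Real.exp_nat_mul, hexpl]
        _ ≤ R := hhalf
    gcongr
  have hmain := twinPrimeCount_le_sieve x z k hz3
  have hfin : 40000 * (x * l ^ 2 / L ^ 2) = 40000 * l ^ 2 * R := by rw [hR]; ring
  rw [hfin]
  have : 12 * R ≤ 7000 * l ^ 2 * R := by gcongr; nlinarith
  linarith

open Filter in
theorem exists_forall_twinPrimeCount_le :
    ∃ x₀ : ℝ, ∀ x : ℝ, x₀ ≤ x → (twinPrimeCount x : ℝ) ≤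
      40000 * (x * (Real.log (Real.log x)) ^ 2 / (Real.log x) ^ 2) := by
  have hlog := Real.tendsto_log_atTop
  have h1 : ∀ᶠ L : ℝ in atTop, 2 ≤ L / (64 * Real.log L) := by
    have h := Real.isLittleO_log_id_atTop.bound (show (0 : ℝ) < 1 / 128 by norm_num)
    filter_upwards [h, eventually_gt_atTop 1] with L hL hL1
    have hpos : 0 < Real.log L := Real.log_pos hL1
    rw [le_div_iff₀ (by positivity)]
    rw [Real.norm_of_nonneg hpos.le, id, Real.norm_of_nonneg (by linarith)] at hL
    linarith
  have h2 : ∀ᶠ L : ℝ in atTop, L ^ 34 ≤ Real.exp (L / 2) := by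
    have h := (isLittleO_pow_exp_pos_mul_atTop 34 (show (0 : ℝ) < 1 / 2 by norm_num)).bound one_pos
    filter_upwards [h, eventually_ge_atTop 0] with L hL hL0
    rw [Real.norm_of_nonneg (by positivity), Real.norm_of_nonneg (by positivity), one_mul] at hL
    rwa [div_eq_inv_mul, ← one_div]
  have h3 : ∀ᶠ L : ℝ in atTop, 8 ≤ Real.log L := hlog.eventually_ge_atTop 8
  obtain ⟨x₀, hx₀⟩ := eventually_atTop.1
    ((hlog.eventually (h1.and (h2.and h3))).and (eventually_ge_atTop 1))
  exact ⟨x₀, fun x hx => by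
    obtain ⟨⟨a, b, c⟩, d⟩ := hx₀ x hx
    exact twinPrimeCount_le_of_large x d c a b⟩

theorem mainTheorem11 :
    ∃ C : ℝ, 0 < C ∧ ∀ x : ℝ, 3 ≤ x →
      (twinPrimeCount x : ℝ) ≤ C * (x * (Real.log (Real.log x)) ^ 2 / (Real.log x) ^ 2) := by
  obtain ⟨x₀, hx₀⟩ := exists_forall_twinPrimeCount_le
  have hlog3 : 1 < Real.log 3 := by
    rw [Real.lt_log_iff_exp_lt (by norm_num)]
    linarith [Real.exp_one_lt_d9]
  set M := max x₀ 3 with hM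
  have hM3 : 3 ≤ M := le_max_right _ _
  have hlogM : 0 < Real.log M := Real.log_pos (by linarith)
  have hll3 : 0 < Real.log (Real.log 3) := Real.log_pos hlog3
  -- on `[3, M]` the count is at most `M + 1`, and `c` bounds the comparison function from below
  set c := 3 * Real.log (Real.log 3) ^ 2 / Real.log M ^ 2 with hc
  have hc0 : 0 < c := by positivity
  refine ⟨max 40000 ((M + 1) / c), by positivity, fun x hx => ?_⟩
  have hlogx : Real.log 3 ≤ Real.log x := Real.log_le_log (by norm_num) hx
  have hllx : Real.log (Real.log 3) ≤ Real.log (Real.log x) :=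
    Real.log_le_log (by linarith) hlogx
  rcases le_total x₀ x with h | h
  · refine (hx₀ x h).trans ?_
    gcongr
    exact le_max_left _ _
  · have hxM : x ≤ M := h.trans (le_max_left _ _)
    have hcount : (twinPrimeCount x : ℝ) ≤ M + 1 := by
      have h1 : twinPrimeCount x ≤ ⌊x⌋₊ + 1 :=
        (Finset.card_filter_le _ _).trans (Finset.card_range _).le
      have h2 : (twinPrimeCount x : ℝ) ≤ (⌊x⌋₊ : ℝ) + 1 := by exact_mod_cast h1
      linarith [Nat.floor_le (show 0 ≤ x by linarith)]
    have hcx : c ≤ x * Real.log (Real.log x) ^ 2 / Real.log x ^ 2 := by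
      have : 0 < Real.log x := by linarith
      rw [hc]
      gcongr
    calc (twinPrimeCount x : ℝ) ≤ M + 1 := hcount
      _ = (M + 1) / c * c := by field_simp
      _ ≤ max 40000 ((M + 1) / c) * (x * Real.log (Real.log x) ^ 2 / Real.log x ^ 2) := by
        gcongr
        exact le_max_right _ _
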